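/- Let $K$ be a positive definite $n\times n$ matrix (real symmetric or complex Hermitian) with eigenvalues, listed with multiplicity in increasing order, $\lambda_1\le\lambda_2\le\dots\le\lambda_n$. For $S\subseteq\{1,\dots,n\}$ let $|K(S)|$ denote the determinant of the principal submatrix of $K$ with rows and columns indexed by $S$, with $|K(\emptyset)|=1$. Let $k,h,p,\ell$ be integers with $1\le k\le h\le p\le n$ and $0\le\ell\le n-p$, and put $P^{\mathrm c}=\{p+1,\dots,n\}$ and $Q_\ell=\{p+1,\dots,p+\ell\}$ (so $Q_0=\emptyset$). Then $$\prod_{i=1}^{h+\ell}\lambda_i\;\le\;|K(Q_\ell)|\left(\prod_{\substack{S\subseteq\{1,\dots,h\}\\ |S|=k}}\frac{|K(S\cup P^{\mathrm c})|}{|K(P^{\mathrm c})|}\right)^{1/\binom{h-1}{k-1}}.$$ -/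

import Mathlib

open scoped ComplexOrder

/-- The interval `[a : b]` of (one-based) indices of an `n × n` matrix: the `i`-th row or column,
`i = 1, …, n`, is the element of `Fin n` with value `i - 1`. -/
def idx (n a b : ℕ) : Finset (Fin n) :=
  {i | a ≤ i.val + 1 ∧ i.val + 1 ≤ b}

/-- The determinant `|K(S)|` of the principal submatrix of `K` with rows and columns in `S`
(equal to `1` for `S = ∅`). It is used for Hermitian `K` only; the determinant is then a real
number, and `RCLike.re` views it as an element of `ℝ`. -/
noncomputable def principalMinor {𝕜 : Type*} [RCLike 𝕜] {n : ℕ} (K : Matrix (Fin n) (Fin n) 𝕜)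
    (S : Finset (Fin n)) : ℝ :=
  RCLike.re (K.submatrix (fun i : S => i.val) (fun i : S => i.val)).det

/-- The eigenvalues of a Hermitian matrix, with multiplicity, in increasing order: the smallest
eigenvalue has index `0`. (Mathlib's `eigenvalues₀` lists them in decreasing order.) -/
noncomputable def incEigenvalues {𝕜 : Type*} [RCLike 𝕜] {n : ℕ} {K : Matrix (Fin n) (Fin n) 𝕜}
    (hK : K.IsHermitian) (i : Fin n) : ℝ :=
  hK.eigenvalues₀ (Fin.cast (Fintype.card_fin n).symm i.rev)

/-!
The set function `S ↦ |K(S)|` is log-submodular: Schur complements reduce the local form of this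
inequality to `2 × 2` matrices. Hence Fischer's inequality holds, and so does Han's inequality for
every contraction `S ↦ |K(S ∪ P)| / |K(P)|`. Han's inequality bounds the averaged product below by
`|K(H ∪ P)| / |K(P)|`, so that it remains to prove
`|K(P)| ∏_{i ≤ #H + #Q} λ_i ≤ |K(Q)| |K(H ∪ P)|` for disjoint `H` and `P` and for `Q ⊆ P`.

By the Cauchy–Binet formula, a principal minor `|K(Tᶜ)|` is a convex combination of products of
`n - #T` eigenvalues, hence at most the product of the largest ones. As `det K` is the product of
all eigenvalues, log-submodularity of `|K(·)|` at `R ∪ T` and `Tᶜ`, for `R` disjoint from `T`, turns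
this into `|K(R)| ∏_{i ≤ #T} λ_i ≤ |K(R ∪ T)|`. Take `R = P \ Q` and `T = H ∪ Q`, and conclude with
Fischer's inequality `|K(P)| ≤ |K(Q)| |K(P \ Q)|`.
-/

open Finset
open scoped Matrix

section CauchyBinet

variable {m n : Type*} [Fintype m] [DecidableEq m] [Fintype n]

-- Summing over all maps `m → n` instead of all `m`-element subsets counts every subset once for
-- each of its orderings, which is the factorial; non-injective maps contribute zero.
theorem factorial_mul_det_mul {R : Type*} [CommRing R] (M : Matrix m n R) (N : Matrix n m R) :
    ((Fintype.card m).factorial : R) * (M * N).det =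
      ∑ f : m → n, (M.submatrix id f).det * (N.submatrix f id).det := by
  have det_expand : (M * N).det = ∑ f : m → n, (∏ i, N (f i) i) * (M.submatrix id f).det := by
    simp only [Matrix.det_apply', Matrix.mul_apply, prod_univ_sum, mul_sum, Fintype.piFinset_univ]
    rw [sum_comm]
    refine sum_congr rfl fun f _ => sum_congr rfl fun σ _ => ?_
    simp only [prod_mul_distrib, Matrix.submatrix_apply, id]
    ring
  have det_expand_perm (σ : Equiv.Perm m) : (M * N).det =
      ∑ f : m → n, (M.submatrix id f).det * (σ.sign * ∏ i, N (f (σ i)) i) := by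
    rw [det_expand, ← (Equiv.arrowCongr σ⁻¹ (Equiv.refl n)).sum_comp]
    refine sum_congr rfl fun f _ => ?_
    have : M.submatrix id (f ∘ σ) = (M.submatrix id f).submatrix id σ := rfl
    change (∏ i, N (f (σ i)) i) * (M.submatrix id (f ∘ σ)).det = _
    rw [this, Matrix.det_permute']
    ring
  calc ((Fintype.card m).factorial : R) * (M * N).det
    _ = ∑ _σ : Equiv.Perm m, (M * N).det := by simp [Fintype.card_perm]
    _ = ∑ σ : Equiv.Perm m, ∑ f : m → n,
          (M.submatrix id f).det * (σ.sign * ∏ i, N (f (σ i)) i) :=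
        sum_congr rfl fun σ _ => det_expand_perm σ
    _ = ∑ f : m → n, (M.submatrix id f).det * (N.submatrix f id).det := by
        rw [sum_comm]
        simp only [← mul_sum, Matrix.det_apply', Matrix.submatrix_apply, id]

variable {𝕜 : Type*} [RCLike 𝕜] [DecidableEq n]

theorem factorial_mul_re_det_conjTranspose_mul_diagonal_mul (B : Matrix n m 𝕜) (d : n → ℝ) :
    ((Fintype.card m).factorial : ℝ) *
        RCLike.re (Bᴴ * Matrix.diagonal (fun i => (d i : 𝕜)) * B).det =
      ∑ f : m → n, (∏ i, d (f i)) * ‖(B.submatrix f id).det‖ ^ 2 := by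
  rw [← RCLike.re_ofReal_mul, RCLike.ofReal_natCast, factorial_mul_det_mul, map_sum]
  refine sum_congr rfl fun f _ => ?_
  have columns : (Bᴴ * Matrix.diagonal (fun i => (d i : 𝕜))).submatrix id f =
      (B.submatrix f id)ᴴ * Matrix.diagonal (fun i => (d (f i) : 𝕜)) := by
    ext i j
    simp [Matrix.mul_diagonal]
  rw [columns, Matrix.det_mul, Matrix.det_conjTranspose, Matrix.det_diagonal, mul_right_comm,
    ← starRingEnd_apply, RCLike.conj_mul]
  norm_cast
  exact mul_comm _ _

theorem re_det_conjTranspose_mul_diagonal_mul_le (B : Matrix n m 𝕜) {d : n → ℝ} {c : ℝ}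
    (hc : ∀ f : m → n, Function.Injective f → ∏ i, d (f i) ≤ c) :
    RCLike.re (Bᴴ * Matrix.diagonal (fun i => (d i : 𝕜)) * B).det ≤
      c * RCLike.re (Bᴴ * B).det := by
  have gram := factorial_mul_re_det_conjTranspose_mul_diagonal_mul B fun _ => 1
  simp only [RCLike.ofReal_one, Matrix.diagonal_one, Matrix.mul_one, prod_const_one,
    one_mul] at gram
  have hpos : (0 : ℝ) < (Fintype.card m).factorial := by positivity
  refine le_of_mul_le_mul_left ?_ hpos
  rw [mul_left_comm, gram, factorial_mul_re_det_conjTranspose_mul_diagonal_mul, mul_sum]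
  refine sum_le_sum fun f _ => ?_
  by_cases hf : Function.Injective f
  · exact mul_le_mul_of_nonneg_right (hc f hf) (sq_nonneg _)
  · obtain ⟨i, j, hij, hne⟩ := Function.not_injective_iff.1 hf
    have : (B.submatrix f id).det = 0 := Matrix.det_zero_of_row_eq hne (by ext; simp [hij])
    simp [this]

theorem re_det_submatrix_le_of_prod_eigenvalues_le {A : Matrix n n 𝕜} (hA : A.IsHermitian)
    {e : m → n} (he : Function.Injective e) {c : ℝ}
    (hc : ∀ f : m → n, Function.Injective f → ∏ i, hA.eigenvalues (f i) ≤ c) :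
    RCLike.re (A.submatrix e e).det ≤ c := by
  set U : Matrix n n 𝕜 := hA.eigenvectorUnitary.1
  set D : Matrix n n 𝕜 := Matrix.diagonal fun i => (hA.eigenvalues i : 𝕜)
  set B : Matrix n m 𝕜 := Uᴴ.submatrix id e
  have hB : Bᴴ = U.submatrix e id := by simp [B]
  have gram : Bᴴ * B = 1 := by
    have hU : U * Uᴴ = 1 := Unitary.coe_mul_star_self hA.eigenvectorUnitary
    calc Bᴴ * B = (U * Uᴴ).submatrix e e := by rw [hB]; rfl
      _ = 1 := by rw [hU, Matrix.submatrix_one _ he]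
  have spectral : A.submatrix e e = Bᴴ * D * B := by
    have hUDU : A = U * D * Uᴴ := by
      have := hA.spectral_theorem
      rwa [Unitary.conjStarAlgAut_apply] at this
    calc A.submatrix e e = (U * D * Uᴴ).submatrix e e := by rw [← hUDU]
      _ = Bᴴ * D * B := by rw [hB]; rfl
  simpa [spectral, gram] using re_det_conjTranspose_mul_diagonal_mul_le B hc

end CauchyBinet

section SchurComplement

variable {m n : Type*} [Fintype m] [DecidableEq m]

/-- The Schur complement of the block of `K` with rows and columns `r`. It is indexed by all rows
and columns of `K`, so that Schur complements of all larger blocks are submatrices of it; it is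
meaningful only if that block is invertible. -/
noncomputable def schurComplement {R : Type*} [CommRing R] (K : Matrix n n R) (r : m → n) :
    Matrix n n R :=
  K - K.submatrix id r * (K.submatrix r r)⁻¹ * K.submatrix r id

theorem isHermitian_schurComplement {R : Type*} [CommRing R] [StarRing R] {K : Matrix n n R}
    (hK : K.IsHermitian) (r : m → n) : (schurComplement K r).IsHermitian := by
  simp only [schurComplement, Matrix.IsHermitian, Matrix.conjTranspose_sub,
    Matrix.conjTranspose_mul, Matrix.conjTranspose_submatrix, hK.eq, (hK.submatrix r).inv.eq,
    Matrix.mul_assoc]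

theorem det_submatrix_sumElim {R ι : Type*} [CommRing R] [Fintype ι] [DecidableEq ι]
    (K : Matrix n n R) {r : m → n} (hr : IsUnit (K.submatrix r r)) (e : ι → n) :
    (K.submatrix (Sum.elim r e) (Sum.elim r e)).det =
      (K.submatrix r r).det * ((schurComplement K r).submatrix e e).det := by
  have := hr.invertible
  have blocks : K.submatrix (Sum.elim r e) (Sum.elim r e) =
      Matrix.fromBlocks (K.submatrix r r) (K.submatrix r e) (K.submatrix e r)
        (K.submatrix e e) := by
    ext (i | i) (j | j) <;> rfl
  rw [blocks, Matrix.det_fromBlocks₁₁, Matrix.invOf_eq_nonsing_inv]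
  rfl

end SchurComplement

section LogSubmodular

theorem prod_powersetCard_prod {α M : Type*} [CommMonoid M] (s : Finset α) (f : α → M) {k : ℕ}
    (hk : 1 ≤ k) :
    ∏ T ∈ s.powersetCard k, ∏ i ∈ T, f i = (∏ i ∈ s, f i) ^ (#s - 1).choose (k - 1) := by
  classical
  rw [prod_comm' (t' := s) (s' := fun i => {T ∈ s.powersetCard k | {i} ⊆ T}), ← prod_pow]
  · refine prod_congr rfl fun i hi => ?_
    rw [prod_const, card_filter_powersetCard_subset _ _ _ (singleton_subset_iff.2 hi) (by simpa),
      card_singleton]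
  · intro T i
    simp only [mem_filter, mem_powersetCard, singleton_subset_iff]
    exact ⟨fun h => ⟨h, h.1.1 h.2⟩, And.left⟩

/-- Submodularity of `log F`, stated multiplicatively for a set function `F`. -/
def IsLogSubmodular {α R : Type*} [DecidableEq α] [Mul R] [LE R] (F : Finset α → R) : Prop :=
  ∀ S T, F (S ∪ T) * F (S ∩ T) ≤ F S * F T

variable {α R : Type*} [DecidableEq α] [Field R] [LinearOrder R] [IsStrictOrderedRing R]
  {F : Finset α → R}

theorem insert_mul_le_insert_mul_of_subset (hpos : ∀ S, 0 < F S)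
    (hlocal : ∀ S i j, i ∉ S → j ∉ S → i ≠ j →
      F (insert i (insert j S)) * F S ≤ F (insert i S) * F (insert j S))
    {S T : Finset α} (hST : S ⊆ T) {i : α} (hi : i ∉ T) :
    F (insert i T) * F S ≤ F (insert i S) * F T := by
  suffices ∀ D, Disjoint S D → i ∉ S ∪ D →
      F (insert i (S ∪ D)) * F S ≤ F (insert i S) * F (S ∪ D) by
    simpa [union_sdiff_of_subset hST, hi] using this (T \ S) disjoint_sdiff
  intro D
  induction D using Finset.induction with
  | empty => simp
  | insert j D hj ih =>
    intro hD hi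
    rw [disjoint_insert_right] at hD
    rw [union_insert, mem_insert, not_or] at hi
    have hjSD : j ∉ S ∪ D := by simp [hD.1, hj]
    rw [union_insert]
    refine le_of_mul_le_mul_left ?_ (hpos (S ∪ D))
    calc F (S ∪ D) * (F (insert i (insert j (S ∪ D))) * F S)
        = F (insert i (insert j (S ∪ D))) * F (S ∪ D) * F S := by ring
      _ ≤ F (insert i (S ∪ D)) * F (insert j (S ∪ D)) * F S :=
        mul_le_mul_of_nonneg_right (hlocal _ i j hi.2 hjSD hi.1) (hpos _).le
      _ = F (insert i (S ∪ D)) * F S * F (insert j (S ∪ D)) := by ring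
      _ ≤ F (insert i S) * F (S ∪ D) * F (insert j (S ∪ D)) :=
        mul_le_mul_of_nonneg_right (ih hD.2 hi.2) (hpos _).le
      _ = F (S ∪ D) * (F (insert i S) * F (insert j (S ∪ D))) := by ring

theorem isLogSubmodular_of_local (hpos : ∀ S, 0 < F S)
    (hlocal : ∀ S i j, i ∉ S → j ∉ S → i ≠ j →
      F (insert i (insert j S)) * F S ≤ F (insert i S) * F (insert j S)) :
    IsLogSubmodular F := by
  intro S T
  suffices ∀ D, Disjoint S D → F (S ∪ D) * F (S ∩ T) ≤ F S * F (S ∩ T ∪ D) by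
    have hT : S ∩ T ∪ T \ S = T := by grind
    simpa [hT] using this (T \ S) disjoint_sdiff
  intro D
  induction D using Finset.induction with
  | empty => simp
  | insert i D hi ih =>
    intro hD
    rw [disjoint_insert_right] at hD
    have step := insert_mul_le_insert_mul_of_subset hpos hlocal (i := i)
      (union_subset_union_left (t := D) (inter_subset_left : S ∩ T ⊆ S))
      (by simp [hD.1, hi])
    rw [union_insert, union_insert]
    refine le_of_mul_le_mul_left ?_ (hpos (S ∩ T ∪ D))
    calc F (S ∩ T ∪ D) * (F (insert i (S ∪ D)) * F (S ∩ T))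
        = F (insert i (S ∪ D)) * F (S ∩ T ∪ D) * F (S ∩ T) := by ring
      _ ≤ F (insert i (S ∩ T ∪ D)) * F (S ∪ D) * F (S ∩ T) :=
        mul_le_mul_of_nonneg_right step (hpos _).le
      _ = F (insert i (S ∩ T ∪ D)) * (F (S ∪ D) * F (S ∩ T)) := by ring
      _ ≤ F (insert i (S ∩ T ∪ D)) * (F S * F (S ∩ T ∪ D)) :=
        mul_le_mul_of_nonneg_left (ih hD.2) (hpos _).le
      _ = F (S ∩ T ∪ D) * (F S * F (insert i (S ∩ T ∪ D))) := by ring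

namespace IsLogSubmodular

theorem contract (hF : IsLogSubmodular F) (P : Finset α) :
    IsLogSubmodular fun S => F (S ∪ P) / F P := by
  intro S T
  dsimp only
  rw [div_mul_div_comm, div_mul_div_comm, union_union_distrib_right, inter_union_distrib_right]
  exact div_le_div_of_nonneg_right (hF _ _) (mul_self_nonneg _)

-- The greedy algorithm: adjoin the elements of `H` one at a time and record the ratios of `F`.
theorem exists_prod_eq_and_prod_le (hF : IsLogSubmodular F) (hpos : ∀ S, 0 < F S)
    (hempty : F ∅ = 1) (H : Finset α) :
    ∃ r : α → R, (∀ i, 0 < r i) ∧ ∏ i ∈ H, r i = F H ∧ ∀ S ⊆ H, ∏ i ∈ S, r i ≤ F S := by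
  induction H using Finset.induction with
  | empty => exact ⟨1, fun _ => one_pos, by simp [hempty], fun S hS => by
      simp [subset_empty.1 hS, hempty]⟩
  | insert a H ha ih =>
    obtain ⟨r, hr, hrH, hrS⟩ := ih
    have hratio : 0 < F (insert a H) / F H := div_pos (hpos _) (hpos _)
    refine ⟨Function.update r a (F (insert a H) / F H), fun i => ?_, ?_, fun S hS => ?_⟩
    · obtain rfl | hia := eq_or_ne i a
      · simpa using hratio
      · simpa [hia] using hr i
    · rw [prod_insert ha, Function.update_self, prod_update_of_notMem ha, hrH,
        div_mul_cancel₀ _ (hpos H).ne']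
    by_cases haS : a ∈ S
    · have hunion : S ∪ H = insert a H := by grind
      have hinter : S ∩ H = S.erase a := by grind
      have hsub := hF S H
      rw [hunion, hinter] at hsub
      rw [prod_update_of_mem haS, sdiff_singleton_eq_erase]
      calc F (insert a H) / F H * ∏ i ∈ S.erase a, r i
          ≤ F (insert a H) / F H * F (S.erase a) :=
            mul_le_mul_of_nonneg_left (hrS _ (by grind)) hratio.le
        _ ≤ F S := by rwa [div_mul_eq_mul_div, div_le_iff₀ (hpos H)]
    · rw [prod_update_of_notMem haS]
      exact hrS S ((subset_insert_iff_of_notMem haS).1 hS)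

theorem pow_choose_le_prod_powersetCard (hF : IsLogSubmodular F) (hpos : ∀ S, 0 < F S)
    (hempty : F ∅ = 1) (H : Finset α) {k : ℕ} (hk : 1 ≤ k) :
    F H ^ (#H - 1).choose (k - 1) ≤ ∏ S ∈ H.powersetCard k, F S := by
  obtain ⟨r, hr, hrH, hrS⟩ := hF.exists_prod_eq_and_prod_le hpos hempty H
  rw [← hrH, ← prod_powersetCard_prod H r hk]
  exact prod_le_prod (fun S _ => prod_nonneg fun i _ => (hr i).le)
    fun S hS => hrS S (mem_powersetCard.1 hS).1

/-- **Han's inequality** in multiplicative form. -/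
theorem le_prod_powersetCard_rpow {F : Finset α → ℝ} (hF : IsLogSubmodular F)
    (hpos : ∀ S, 0 < F S) (hempty : F ∅ = 1) {H : Finset α} {k : ℕ} (hk : 1 ≤ k) (hkH : k ≤ #H) :
    F H ≤ (∏ S ∈ H.powersetCard k, F S) ^ (1 / ((#H - 1).choose (k - 1) : ℝ)) := by
  have hchoose : (#H - 1).choose (k - 1) ≠ 0 := (Nat.choose_pos (by omega)).ne'
  calc F H = (F H ^ (#H - 1).choose (k - 1)) ^ (1 / ((#H - 1).choose (k - 1) : ℝ)) := by
        rw [one_div, Real.pow_rpow_inv_natCast (hpos H).le hchoose]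
    _ ≤ _ := Real.rpow_le_rpow (pow_nonneg (hpos H).le _)
        (hF.pow_choose_le_prod_powersetCard hpos hempty H hk) (by positivity)

end IsLogSubmodular

end LogSubmodular

section PrincipalMinor

variable {𝕜 : Type*} [RCLike 𝕜] {n : ℕ} {K : Matrix (Fin n) (Fin n) 𝕜}

theorem principalMinor_empty (K : Matrix (Fin n) (Fin n) 𝕜) : principalMinor K ∅ = 1 := by
  simp [principalMinor]

theorem principalMinor_eq_re_det_submatrix {ι : Type*} [Fintype ι] [DecidableEq ι]
    (K : Matrix (Fin n) (Fin n) 𝕜) {e : ι → Fin n} (he : Function.Injective e)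
    {S : Finset (Fin n)} (hS : Set.range e = S) :
    principalMinor K S = RCLike.re (K.submatrix e e).det := by
  let φ : ι ≃ S := (Equiv.ofInjective e he).trans (Equiv.setCongr hS)
  rw [principalMinor, ← Matrix.det_submatrix_equiv_self φ]
  rfl

theorem principalMinor_univ (K : Matrix (Fin n) (Fin n) 𝕜) :
    principalMinor K univ = RCLike.re K.det :=
  principalMinor_eq_re_det_submatrix K Function.injective_id (by simp)

theorem principalMinor_singleton (K : Matrix (Fin n) (Fin n) 𝕜) (i : Fin n) :
    principalMinor K {i} = RCLike.re (K i i) := by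
  rw [principalMinor_eq_re_det_submatrix K (e := fun _ : Unit => i) (fun _ _ _ => rfl) (by simp)]
  simp

theorem principalMinor_pair_le (hK : K.IsHermitian) {i j : Fin n} (hij : i ≠ j) :
    principalMinor K {i, j} ≤ principalMinor K {i} * principalMinor K {j} := by
  have off_diagonal : K i j * K j i = ((‖K i j‖ ^ 2 : ℝ) : 𝕜) := by
    rw [← hK.apply j i, ← starRingEnd_apply, RCLike.mul_conj, RCLike.ofReal_pow]
  have hinj : Function.Injective ![i, j] := by
    simpa [Function.Injective, Fin.forall_fin_two] using ⟨hij, hij.symm⟩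
  rw [principalMinor_eq_re_det_submatrix K hinj (by simp [Set.pair_comm]), Matrix.det_fin_two,
    principalMinor_singleton, principalMinor_singleton]
  simp only [Matrix.submatrix_apply, Matrix.cons_val_zero, Matrix.cons_val_one, off_diagonal,
    map_sub, RCLike.ofReal_re]
  rw [← hK.coe_re_apply_self i, RCLike.re_ofReal_mul, RCLike.ofReal_re]
  exact sub_le_self _ (sq_nonneg _)

theorem principalMinor_pos (hK : K.PosDef) (S : Finset (Fin n)) : 0 < principalMinor K S :=
  (RCLike.pos_iff.1 (hK.submatrix Subtype.val_injective).det_pos).1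

theorem principalMinor_union (hK : K.PosDef) {S T : Finset (Fin n)} (hST : Disjoint S T) :
    principalMinor K (S ∪ T) =
      principalMinor K S * principalMinor (schurComplement K ((↑) : S → Fin n)) T := by
  have hblock : (K.submatrix ((↑) : S → Fin n) (↑)).PosDef :=
    hK.submatrix Subtype.val_injective
  have hinj : Function.Injective (Sum.elim ((↑) : S → Fin n) ((↑) : T → Fin n)) :=
    Subtype.val_injective.sumElim Subtype.val_injective fun i j hij =>
      disjoint_left.1 hST i.2 (hij ▸ j.2)
  have hreal : (K.submatrix ((↑) : S → Fin n) (↑)).det = (principalMinor K S : 𝕜) :=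
    (RCLike.conj_eq_iff_re.1 (RCLike.conj_eq_iff_im.2 (RCLike.pos_iff.1 hblock.det_pos).2)).symm
  rw [principalMinor_eq_re_det_submatrix K hinj (by simp [Set.Sum.elim_range]),
    det_submatrix_sumElim K hblock.isUnit, hreal, RCLike.re_ofReal_mul]
  rfl

theorem isLogSubmodular_principalMinor (hK : K.PosDef) : IsLogSubmodular (principalMinor K) := by
  refine isLogSubmodular_of_local (principalMinor_pos hK) fun S i j hi hj hij => ?_
  set M := schurComplement K ((↑) : S → Fin n)
  have hpair : principalMinor K (insert i (insert j S)) =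
      principalMinor K S * principalMinor M {i, j} := by
    rw [← principalMinor_union hK (by simp [hi, hj])]
    congr 1
    grind
  have hsingle (a : Fin n) (ha : a ∉ S) :
      principalMinor K (insert a S) = principalMinor K S * principalMinor M {a} := by
    rw [← principalMinor_union hK (by simpa), union_singleton]
  calc principalMinor K (insert i (insert j S)) * principalMinor K S
      = principalMinor K S * principalMinor K S * principalMinor M {i, j} := by rw [hpair]; ring
    _ ≤ principalMinor K S * principalMinor K S * (principalMinor M {i} * principalMinor M {j}) :=
      mul_le_mul_of_nonneg_left
        (principalMinor_pair_le (isHermitian_schurComplement hK.isHermitian _) hij)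
        (mul_self_nonneg _)
    _ = principalMinor K (insert i S) * principalMinor K (insert j S) := by
      rw [hsingle i hi, hsingle j hj]; ring

/-- **Fischer's inequality**. -/
theorem principalMinor_union_le (hK : K.PosDef) {S T : Finset (Fin n)} (hST : Disjoint S T) :
    principalMinor K (S ∪ T) ≤ principalMinor K S * principalMinor K T := by
  simpa [disjoint_iff_inter_eq_empty.1 hST, principalMinor_empty] using
    isLogSubmodular_principalMinor hK S T

end PrincipalMinor

section Eigenvalues

theorem card_idx_succ {n a b : ℕ} (hb : b ≤ n) : #(idx n (a + 1) b) = b - a := by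
  rw [← Nat.card_Ico a b, ← card_map Fin.valEmbedding]
  congr 1
  ext x
  simp only [idx, mem_map, mem_filter_univ, mem_Ico, Fin.valEmbedding_apply]
  exact ⟨by rintro ⟨i, hi, rfl⟩; omega, fun hx => ⟨⟨x, by omega⟩, by grind⟩⟩

theorem prod_le_prod_of_card_eq {ι R : Type*} [DecidableEq ι] [CommSemiring R]
    [PartialOrder R] [IsOrderedRing R] {f : ι → R}
    (hf : ∀ i, 0 ≤ f i) {s t : Finset ι} (hcard : #s = #t)
    (hst : ∀ i ∈ s \ t, ∀ j ∈ t \ s, f i ≤ f j) : ∏ i ∈ s, f i ≤ ∏ i ∈ t, f i := by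
  let φ : ↥(s \ t) ≃ ↥(t \ s) := equivOfCardEq (card_sdiff_comm hcard)
  have exchange : ∏ i ∈ s \ t, f i ≤ ∏ i ∈ t \ s, f i :=
    calc ∏ i ∈ s \ t, f i = ∏ i : ↥(s \ t), f i := (prod_coe_sort _ _).symm
      _ ≤ ∏ i : ↥(s \ t), f (φ i) :=
        prod_le_prod (fun i _ => hf i) fun i _ => hst i i.2 (φ i) (φ i).2
      _ = ∏ i : ↥(t \ s), f i := φ.prod_comp fun i => f i
      _ = ∏ i ∈ t \ s, f i := prod_coe_sort _ _
  rw [← prod_inter_mul_prod_sdiff s t f, ← prod_inter_mul_prod_sdiff t s f, inter_comm t s]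
  exact mul_le_mul_of_nonneg_left exchange (prod_nonneg fun i _ => hf i)

variable {𝕜 : Type*} [RCLike 𝕜] {n : ℕ} {K : Matrix (Fin n) (Fin n) 𝕜}

theorem incEigenvalues_monotone (hK : K.IsHermitian) : Monotone (incEigenvalues hK) :=
  fun i j hij => hK.eigenvalues₀_antitone (by simpa [Fin.le_def] using Fin.rev_le_rev.2 hij)

theorem exists_perm_incEigenvalues_eq (hK : K.IsHermitian) :
    ∃ σ : Equiv.Perm (Fin n), ∀ i, incEigenvalues hK (σ i) = hK.eigenvalues i :=
  ⟨(Fintype.equivOfCardEq (Fintype.card_fin (Fintype.card (Fin n)))).symm.trans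
    ((finCongr (Fintype.card_fin n)).trans Fin.revPerm),
    fun i => by simp [incEigenvalues, Matrix.IsHermitian.eigenvalues]⟩

theorem incEigenvalues_nonneg (hK : K.PosSemidef) (i : Fin n) :
    0 ≤ incEigenvalues hK.isHermitian i := by
  obtain ⟨σ, hσ⟩ := exists_perm_incEigenvalues_eq hK.isHermitian
  rw [← σ.apply_symm_apply i, hσ]
  exact hK.eigenvalues_nonneg _

theorem prod_incEigenvalues (hK : K.IsHermitian) :
    ∏ i, incEigenvalues hK i = principalMinor K univ := by
  obtain ⟨σ, hσ⟩ := exists_perm_incEigenvalues_eq hK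
  rw [principalMinor_univ, hK.det_eq_prod_eigenvalues, ← RCLike.ofReal_prod, RCLike.ofReal_re,
    ← Equiv.prod_comp σ]
  exact prod_congr rfl fun i _ => hσ i

theorem principalMinor_compl_le_prod_incEigenvalues (hK : K.PosSemidef) (S : Finset (Fin n)) :
    principalMinor K Sᶜ ≤ ∏ i ∈ (idx n 1 #S)ᶜ, incEigenvalues hK.isHermitian i := by
  obtain ⟨σ, hσ⟩ := exists_perm_incEigenvalues_eq hK.isHermitian
  refine re_det_submatrix_le_of_prod_eigenvalues_le hK.isHermitian Subtype.val_injective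
    fun f hf => ?_
  have hinj : Function.Injective fun i => σ (f i) := σ.injective.comp hf
  have hS : #S ≤ n := by simpa using S.card_le_univ
  calc ∏ i, hK.isHermitian.eigenvalues (f i)
      = ∏ i ∈ univ.image fun i => σ (f i), incEigenvalues hK.isHermitian i := by
        rw [prod_image hinj.injOn]
        exact prod_congr rfl fun i _ => (hσ _).symm
    _ ≤ ∏ i ∈ (idx n 1 #S)ᶜ, incEigenvalues hK.isHermitian i := by
        refine prod_le_prod_of_card_eq (incEigenvalues_nonneg hK) ?_ fun i hi j hj => ?_
        · rw [card_image_of_injective _ hinj, card_univ, Fintype.card_coe, card_compl, card_compl,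
            card_idx_succ hS, Nat.sub_zero]
        · refine incEigenvalues_monotone hK.isHermitian ?_
          simp only [idx, mem_sdiff, mem_compl, mem_filter_univ] at hi hj
          omega

theorem principalMinor_mul_prod_incEigenvalues_le (hK : K.PosDef) {S T : Finset (Fin n)}
    (hST : Disjoint S T) :
    principalMinor K S * ∏ i ∈ idx n 1 #T, incEigenvalues hK.isHermitian i ≤
      principalMinor K (S ∪ T) := by
  have hunion : S ∪ T ∪ Tᶜ = univ := by simp [union_assoc]
  have hinter : (S ∪ T) ∩ Tᶜ = S := by grind [disjoint_left, mem_compl]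
  have hsub := isLogSubmodular_principalMinor hK (S ∪ T) Tᶜ
  rw [hunion, hinter, ← prod_incEigenvalues hK.isHermitian] at hsub
  refine le_of_mul_le_mul_right ?_ (principalMinor_pos hK Tᶜ)
  calc principalMinor K S * (∏ i ∈ idx n 1 #T, incEigenvalues hK.isHermitian i) *
        principalMinor K Tᶜ
      ≤ principalMinor K S * (∏ i ∈ idx n 1 #T, incEigenvalues hK.isHermitian i) *
        ∏ i ∈ (idx n 1 #T)ᶜ, incEigenvalues hK.isHermitian i :=
        mul_le_mul_of_nonneg_left
          (principalMinor_compl_le_prod_incEigenvalues hK.posSemidef T)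
          (mul_nonneg (principalMinor_pos hK S).le
            (prod_nonneg fun i _ => incEigenvalues_nonneg hK.posSemidef i))
    _ = (∏ i, incEigenvalues hK.isHermitian i) * principalMinor K S := by
        rw [mul_assoc, prod_mul_prod_compl, mul_comm]
    _ ≤ principalMinor K (S ∪ T) * principalMinor K Tᶜ := hsub

theorem prod_incEigenvalues_mul_principalMinor_le (hK : K.PosDef) {H P Q : Finset (Fin n)}
    (hHP : Disjoint H P) (hQP : Q ⊆ P) :
    (∏ i ∈ idx n 1 (#H + #Q), incEigenvalues hK.isHermitian i) * principalMinor K P ≤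
      principalMinor K Q * principalMinor K (H ∪ P) := by
  have hHQ : #(H ∪ Q) = #H + #Q := card_union_of_disjoint (hHP.mono_right hQP)
  have hunion : P \ Q ∪ (H ∪ Q) = H ∪ P := by grind
  have hfischer := principalMinor_union_le hK (disjoint_sdiff (s := Q) (t := P))
  have heigen := principalMinor_mul_prod_incEigenvalues_le hK (S := P \ Q) (T := H ∪ Q)
    (by grind [disjoint_left])
  rw [union_sdiff_of_subset hQP] at hfischer
  rw [hHQ, hunion] at heigen
  calc (∏ i ∈ idx n 1 (#H + #Q), incEigenvalues hK.isHermitian i) * principalMinor K P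
      ≤ (∏ i ∈ idx n 1 (#H + #Q), incEigenvalues hK.isHermitian i) *
          (principalMinor K Q * principalMinor K (P \ Q)) :=
        mul_le_mul_of_nonneg_left hfischer
          (prod_nonneg fun i _ => incEigenvalues_nonneg hK.posSemidef i)
    _ = principalMinor K Q * (principalMinor K (P \ Q) *
          ∏ i ∈ idx n 1 (#H + #Q), incEigenvalues hK.isHermitian i) := by ring
    _ ≤ principalMinor K Q * principalMinor K (H ∪ P) :=
        mul_le_mul_of_nonneg_left heigen (principalMinor_pos hK Q).le

end Eigenvalues

theorem theorem5_general {𝕜 : Type*} [RCLike 𝕜] {n : ℕ} {K : Matrix (Fin n) (Fin n) 𝕜}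
    (hK : K.PosDef) {H P Q : Finset (Fin n)} (hHP : Disjoint H P) (hQP : Q ⊆ P) {k : ℕ}
    (hk : 1 ≤ k) (hkH : k ≤ #H) :
    ∏ i ∈ idx n 1 (#H + #Q), incEigenvalues hK.isHermitian i ≤
      principalMinor K Q *
        (∏ S ∈ H.powersetCard k, principalMinor K (S ∪ P) / principalMinor K P) ^
          (1 / ((#H - 1).choose (k - 1) : ℝ)) := by
  have hpos := principalMinor_pos hK
  have hhan := ((isLogSubmodular_principalMinor hK).contract P).le_prod_powersetCard_rpow
    (fun S => div_pos (hpos _) (hpos _)) (by simp [(hpos P).ne']) hk hkH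
  calc ∏ i ∈ idx n 1 (#H + #Q), incEigenvalues hK.isHermitian i
      ≤ principalMinor K Q * (principalMinor K (H ∪ P) / principalMinor K P) := by
        rw [← mul_div_assoc, le_div_iff₀ (hpos P)]
        exact prod_incEigenvalues_mul_principalMinor_le hK hHP hQP
    _ ≤ _ := mul_le_mul_of_nonneg_left hhan (hpos Q).le

theorem theorem5 {𝕜 : Type*} [RCLike 𝕜] (n : ℕ) (K : Matrix (Fin n) (Fin n) 𝕜) (hK : K.PosDef)
    (k h p l : ℕ) (hk : 1 ≤ k) (hkh : k ≤ h) (hhp : h ≤ p) (hpn : p ≤ n) (hl : l ≤ n - p) :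
    ∏ i ∈ idx n 1 (h + l), incEigenvalues hK.isHermitian i ≤
      principalMinor K (idx n (p + 1) (p + l)) *
        (∏ S ∈ (idx n 1 h).powersetCard k,
          principalMinor K (S ∪ (idx n 1 p)ᶜ) / principalMinor K (idx n 1 p)ᶜ) ^
            (1 / ((h - 1).choose (k - 1) : ℝ)) := by
  have hH : #(idx n 1 h) = h := card_idx_succ (a := 0) (hhp.trans hpn)
  have hQ : #(idx n (p + 1) (p + l)) = l := by
    rw [card_idx_succ (by omega), Nat.add_sub_cancel_left]
  simpa only [hH, hQ] using theorem5_general hK (H := idx n 1 h) (P := (idx n 1 p)ᶜ)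
    (Q := idx n (p + 1) (p + l)) (by grind [idx, disjoint_left, mem_compl])
    (by grind [idx, mem_compl]) hk (by rwa [hH])
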